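/- A hypergraph $\mathcal H=(V,H)$ consists of a set $V$ of vertices and a set $H$ of subsets of $V$, called hyperedges; it is finite if $V$ is finite. The dual hypergraph $\mathcal H^*$ has vertex set $H$, and its hyperedges are the sets $h_v=\{h\in H : v\in h\}$ for $v\in V$. The theta complex $\Theta(\mathcal H)$ is the simplicial complex whose simplices are the nonempty finite subsets of the complements $V\setminus h$ of the hyperedges $h\in H$ (so a vertex of $\mathcal H$ that lies in every hyperedge is not a vertex of $\Theta(\mathcal H)$). **Theorem.** Let $\mathcal H$ be a finite hypergraph. Then the geometric realizations of $\Theta(\mathcal H^*)$ and $\Theta(\mathcal H)$ are homotopy equivalent: $\Theta(\mathcal H^*)\simeq\Theta(\mathcal H)$. -/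

import Mathlib

namespace Hypergraph

/-- The dual hypergraph: its vertices are the hyperedges of `H`, and each vertex `v` of `H` gives
the hyperedge consisting of all hyperedges of `H` that contain `v`. -/
def dual {α : Type*} (H : Hypergraph α) : Hypergraph (Set α) where
  vertexSet := H.edgeSet
  edgeSet := {S | ∃ v ∈ H.vertexSet, S = {e | e ∈ H.edgeSet ∧ v ∈ e}}
  subset_vertexSet_of_mem_edgeSet' := by
    rintro S ⟨v, -, rfl⟩ e he
    exact he.1

/-- The theta complex: its simplices are the nonempty finite subsets of the complements (in the
vertex set) of hyperedges. A vertex lying in every hyperedge of `H` is not a vertex of it. -/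
def theta {α : Type*} (H : Hypergraph α) : PreAbstractSimplicialComplex α where
  faces := {s | s.Nonempty ∧ ∃ e ∈ H.edgeSet, (s : Set α) ⊆ H.vertexSet \ e}
  isRelLowerSet_faces := by
    rintro s ⟨hs, e, he, hse⟩
    exact ⟨hs, fun t hts ht => ⟨ht, e, he, (Finset.coe_subset.2 hts).trans hse⟩⟩

end Hypergraph

/-- The geometric realization of a finite simplicial complex, in barycentric coordinates: the union
over the faces `s` of the standard simplices with vertex set `s`, with the topology induced from
the product `ι → ℝ` (for finitely many faces, this is the usual topology of the realization). -/
def PreAbstractSimplicialComplex.realization {ι : Type*} (K : PreAbstractSimplicialComplex ι) :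
    Set (ι → ℝ) :=
  {x | ∃ s ∈ K.faces, (∀ i, 0 ≤ x i) ∧ (∀ i, i ∉ s → x i = 0) ∧ ∑ i ∈ s, x i = 1}

/-! Both theta complexes are Dowker complexes of non-incidence `v ∉ e`, read from its two sides, so
this is Dowker duality. The map `toDual` sends `x` to weights on those `j` related to every `i` with
`x i ≥ 1 / #X`; such an `i` exists and is a common relative of the image's support. A `j` related to
the whole support of `x` gets maximal weight, so it survives the same threshold on the way back.
Hence `x` and its round trip share a face, and a straight-line homotopy joins them. -/

/-- The realization of the Dowker complex of the relation `R` between the finite sets `X` and `Y`: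
points with barycentric coordinates supported on elements of `X` related to a common element
of `Y`. -/
def dowkerRealization {ι κ : Type*} (X : Finset ι) (Y : Finset κ) (R : ι → κ → Prop) :
    Set (ι → ℝ) :=
  {x | (∀ i, 0 ≤ x i) ∧ (∃ j ∈ Y, ∀ i, x i ≠ 0 → i ∈ X ∧ R i j) ∧ ∑ i ∈ X, x i = 1}

namespace dowkerRealization

variable {ι κ : Type*} {X : Finset ι} {Y : Finset κ} {R : ι → κ → Prop}

open Classical in
/-- The unnormalized weight of `j`: it is positive iff every `i ∈ X` whose coordinate is at least
`1 / #X` is related to `j`. -/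
noncomputable def weight (X : Finset ι) (Y : Finset κ) (R : ι → κ → Prop) (x : ι → ℝ) (j : κ) :
    ℝ :=
  if j ∈ Y then ∏ i ∈ X with ¬ R i j, max 0 (1 - X.card * x i) else 0

lemma continuous_weight (j : κ) : Continuous fun x => weight X Y R x j := by
  unfold weight
  split_ifs <;> fun_prop

lemma weight_nonneg (x : ι → ℝ) (j : κ) : 0 ≤ weight X Y R x j := by
  unfold weight
  split_ifs
  · exact Finset.prod_nonneg fun i _ => le_max_left _ _
  · exact le_rfl

lemma weight_le_one {x : ι → ℝ} (hx : ∀ i, 0 ≤ x i) (j : κ) : weight X Y R x j ≤ 1 := by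
  unfold weight
  split_ifs
  · refine Finset.prod_le_one (fun i _ => le_max_left _ _) fun i _ => max_le zero_le_one ?_
    have := mul_nonneg (Nat.cast_nonneg (α := ℝ) X.card) (hx i)
    linarith
  · exact zero_le_one

lemma mem_of_weight_ne_zero {x : ι → ℝ} {j : κ} (h : weight X Y R x j ≠ 0) : j ∈ Y := by
  by_contra hj
  exact h (if_neg hj)

open Classical in
lemma weight_eq_one {x : ι → ℝ} {j : κ} (hj : j ∈ Y) (h : ∀ i, x i ≠ 0 → i ∈ X ∧ R i j) :
    weight X Y R x j = 1 := by
  unfold weight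
  rw [if_pos hj]
  refine Finset.prod_eq_one fun i hi => ?_
  have : x i = 0 := by
    by_contra h0
    exact (Finset.mem_filter.1 hi).2 (h i h0).2
  simp [this]

open Classical in
lemma rel_of_weight_ne_zero {x : ι → ℝ} {i : ι} {j : κ} (h : weight X Y R x j ≠ 0)
    (hi : i ∈ X) (hxi : 1 ≤ X.card * x i) : R i j := by
  by_contra hR
  have hj := mem_of_weight_ne_zero h
  unfold weight at h
  rw [if_pos hj] at h
  refine h (Finset.prod_eq_zero (Finset.mem_filter.2 ⟨hi, hR⟩) (max_eq_left ?_))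
  linarith

lemma one_le_sum_weight {x : ι → ℝ} (hx : x ∈ dowkerRealization X Y R) :
    1 ≤ ∑ j ∈ Y, weight X Y R x j := by
  obtain ⟨-, ⟨j, hj, h⟩, -⟩ := hx
  rw [← weight_eq_one hj h]
  exact Finset.single_le_sum (fun j _ => weight_nonneg x j) hj

lemma exists_one_le_card_mul {x : ι → ℝ} (hx : x ∈ dowkerRealization X Y R) :
    ∃ i ∈ X, 1 ≤ X.card * x i := by
  have hX : X.Nonempty := by
    rw [Finset.nonempty_iff_ne_empty]
    rintro rfl
    simpa using hx.2.2
  refine Finset.exists_le_of_sum_le (f := fun _ => 1) hX ?_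
  rw [← Finset.mul_sum, hx.2.2]
  simp

/-- The normalized weights. -/
noncomputable def normWeight (X : Finset ι) (Y : Finset κ) (R : ι → κ → Prop) (x : ι → ℝ) (j : κ) :
    ℝ :=
  weight X Y R x j / ∑ k ∈ Y, weight X Y R x k

lemma normWeight_mem {x : ι → ℝ} (hx : x ∈ dowkerRealization X Y R) :
    normWeight X Y R x ∈ dowkerRealization Y X (flip R) := by
  have hpos := one_le_sum_weight hx
  obtain ⟨i, hi, hxi⟩ := exists_one_le_card_mul hx
  refine ⟨fun j => div_nonneg (weight_nonneg x j) (by linarith), ⟨i, hi, fun j hj => ?_⟩, ?_⟩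
  · have hw : weight X Y R x j ≠ 0 := (div_ne_zero_iff.1 hj).1
    have hR : R i j := rel_of_weight_ne_zero hw hi hxi
    exact ⟨mem_of_weight_ne_zero hw, hR⟩
  · simp only [normWeight]
    rw [← Finset.sum_div, div_self (by linarith)]

/-- The weight of such a `j` is 1, the largest possible, so its normalized share is at least the
average. -/
lemma one_le_card_mul_normWeight {x : ι → ℝ} (hx : x ∈ dowkerRealization X Y R) {j : κ}
    (hj : j ∈ Y) (h : ∀ i, x i ≠ 0 → i ∈ X ∧ R i j) : 1 ≤ Y.card * normWeight X Y R x j := by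
  have hpos := one_le_sum_weight hx
  rw [normWeight, weight_eq_one hj h, mul_one_div, one_le_div (by linarith)]
  simpa using Finset.sum_le_card_nsmul Y _ 1 fun j _ => weight_le_one (R := R) (X := X) hx.1 j

/-- The map between the realizations of the two Dowker complexes of a relation. -/
noncomputable def toDual (X : Finset ι) (Y : Finset κ) (R : ι → κ → Prop) :
    C(dowkerRealization X Y R, dowkerRealization Y X (flip R)) where
  toFun x := ⟨normWeight X Y R x, normWeight_mem x.2⟩
  continuous_toFun := by
    refine Continuous.subtype_mk (continuous_pi fun j => ?_) _
    refine Continuous.div ((continuous_weight j).comp continuous_subtype_val)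
      (continuous_finsetSum _ fun k _ => (continuous_weight k).comp continuous_subtype_val)
      fun x => ?_
    have := one_le_sum_weight x.2
    linarith

lemma lineMap_mem (x : dowkerRealization X Y R) (t : unitInterval) :
    (fun i => (1 - t : ℝ) * (toDual Y X (flip R) (toDual X Y R x)).1 i + t * x.1 i) ∈
      dowkerRealization X Y R := by
  set y := toDual Y X (flip R) (toDual X Y R x) with hy
  have ht := t.2.1
  have ht' : 0 ≤ (1 - t : ℝ) := sub_nonneg.2 t.2.2
  -- This `j` spans a face containing the supports of both `x` and `y`.
  obtain ⟨j, hj, h⟩ := x.2.2.1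
  refine ⟨fun i => add_nonneg (mul_nonneg ht' (y.2.1 i)) (mul_nonneg ht (x.2.1 i)),
    ⟨j, hj, fun i hi => ?_⟩, ?_⟩
  · by_cases hxi : x.1 i = 0
    · have hyi : y.1 i ≠ 0 := fun h0 => hi (by simp [h0, hxi])
      have hw := (div_ne_zero_iff.1 hyi).1
      have hR : flip R j i :=
        rel_of_weight_ne_zero hw hj (one_le_card_mul_normWeight x.2 hj h)
      exact ⟨mem_of_weight_ne_zero hw, hR⟩
    · exact h i hxi
  · rw [Finset.sum_add_distrib, ← Finset.mul_sum, ← Finset.mul_sum, x.2.2.2, y.2.2.2]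
    ring

lemma toDual_comp_toDual_homotopic (X : Finset ι) (Y : Finset κ) (R : ι → κ → Prop) :
    ((toDual Y X (flip R)).comp (toDual X Y R)).Homotopic
      (ContinuousMap.id (dowkerRealization X Y R)) := by
  refine ⟨⟨⟨fun p => ⟨_, lineMap_mem p.2 p.1⟩, ?_⟩, fun x => ?_, fun x => ?_⟩⟩
  · refine Continuous.subtype_mk (continuous_pi fun i => ?_) _
    have h1 : Continuous fun x : dowkerRealization X Y R =>
        (toDual Y X (flip R) (toDual X Y R x)).1 i :=
      (continuous_apply i).comp (continuous_subtype_val.comp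
        ((toDual Y X (flip R)).comp (toDual X Y R)).continuous)
    have h2 : Continuous fun x : dowkerRealization X Y R => x.1 i :=
      (continuous_apply i).comp continuous_subtype_val
    have h3 : Continuous fun p : unitInterval × dowkerRealization X Y R => (p.1 : ℝ) :=
      continuous_subtype_val.comp continuous_fst
    exact ((continuous_const.sub h3).mul (h1.comp continuous_snd)).add
      (h3.mul (h2.comp continuous_snd))
  · ext i
    simp
  · ext i
    simp only [Set.Icc.coe_one, sub_self, zero_mul, one_mul, zero_add]
    rfl

/-- **Dowker duality** for finite relations. -/
noncomputable def homotopyEquivDual (X : Finset ι) (Y : Finset κ) (R : ι → κ → Prop) :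
    ContinuousMap.HomotopyEquiv (dowkerRealization X Y R) (dowkerRealization Y X (flip R)) where
  toFun := toDual X Y R
  invFun := toDual Y X (flip R)
  left_inv := toDual_comp_toDual_homotopic X Y R
  -- `flip (flip R)` is `R` by definition.
  right_inv := toDual_comp_toDual_homotopic Y X (flip R)

end dowkerRealization

open Classical in
/-- A complex whose faces are the nonempty subsets of `X` with a common `R`-relative in `Y` has the
corresponding Dowker realization. -/
lemma PreAbstractSimplicialComplex.realization_eq_dowkerRealization {ι κ : Type*}
    (K : PreAbstractSimplicialComplex ι) (X : Finset ι) (Y : Finset κ) (R : ι → κ → Prop)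
    (hK : ∀ s, s ∈ K.faces ↔ s.Nonempty ∧ ∃ j ∈ Y, ∀ i ∈ s, i ∈ X ∧ R i j) :
    K.realization = dowkerRealization X Y R := by
  ext x
  constructor
  · rintro ⟨s, hs, h0, hsupp, hsum⟩
    obtain ⟨-, j, hj, h⟩ := (hK s).1 hs
    refine ⟨h0, ⟨j, hj, fun i hi => h i (not_imp_comm.1 (hsupp i) hi)⟩, ?_⟩
    rw [← hsum]
    exact (Finset.sum_subset (fun i hi => (h i hi).1) fun i _ hi => hsupp i hi).symm
  · rintro ⟨h0, ⟨j, hj, h⟩, hsum⟩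
    have hsum' : ∑ i ∈ X with x i ≠ 0, x i = 1 := by rw [Finset.sum_filter_ne_zero, hsum]
    refine ⟨X.filter (x · ≠ 0), (hK _).2 ⟨?_, j, hj, fun i hi => h i (Finset.mem_filter.1 hi).2⟩,
      h0, fun i hi => ?_, hsum'⟩
    · exact Finset.nonempty_of_sum_ne_zero (hsum'.trans_ne one_ne_zero)
    · by_contra hne
      exact hi (Finset.mem_filter.2 ⟨(h i hne).1, hne⟩)

theorem mainTheorem5 {α : Type*} (H : Hypergraph α) (hfin : H.vertexSet.Finite) :
    Nonempty (ContinuousMap.HomotopyEquiv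
      ↥(H.dual.theta.realization) ↥(H.theta.realization)) := by
  have hE : H.edgeSet.Finite :=
    hfin.finite_subsets.subset fun e he => H.subset_vertexSet_of_mem_edgeSet he
  have h1 : H.theta.realization =
      dowkerRealization hfin.toFinset hE.toFinset fun v e => v ∉ e := by
    refine PreAbstractSimplicialComplex.realization_eq_dowkerRealization _ _ _ _ fun s => ?_
    simp [Hypergraph.theta, Set.subset_def]
  -- In the dual, the complement of `h_v` is the set of hyperedges avoiding `v`.
  have h2 : H.dual.theta.realization =
      dowkerRealization hE.toFinset hfin.toFinset (flip fun v e => v ∉ e) := by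
    refine PreAbstractSimplicialComplex.realization_eq_dowkerRealization _ _ _ _ fun s => ?_
    simp only [Hypergraph.theta, Hypergraph.dual, Set.subset_def, flip, Set.mem_ofPred_eq,
      Set.Finite.mem_toFinset]
    aesop
  rw [h1, h2]
  exact ⟨(dowkerRealization.homotopyEquivDual _ _ _).symm⟩
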